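/- Fix $k$ with $2\le k<\omega$. A \emph{template of arity $k$} is a sequence $\mathcal H=\langle (H_n,E_n):n<\omega\rangle$ with a function $f_{\mathcal H}:\omega\to\omega\setminus\{0\}$, $\lim_n f_{\mathcal H}(n)=\infty$, such that for all $n$: $H_n$ is a natural number, identified with $\{0,\dots,H_n-1\}$, and $f_{\mathcal H}(n)\le H_n$; $E_n\subseteq H_n^k$ contains every $k$-tuple with fewer than $k$ distinct entries and is symmetric on tuples of $k$ distinct entries; and (Extension) for any $t=f_{\mathcal H}(n)$ tuples $(i^\ell_0,\dots,i^\ell_{k-2})\in H_n^{k-1}$, $\ell<t$, there is $s\in H_n$ with $(s,i^\ell_0,\dots,i^\ell_{k-2})\in E_n$ for all $\ell<t$. Let $X_{\mathcal H}$ be the set of finite sequences $\eta$ with $\eta(n)<H_n$ for all $n<\operatorname{lgn}(\eta)$. Let $T_0(\mathcal H)$ be the universal theory, in the language with a $k$-ary relation $R$ and unary predicates $Q_\eta$ ($\eta\in X_{\mathcal H}$), which says: $R$ is symmetric and holds only on tuples of $k$ distinct elements; $Q_{\langle\rangle}$ holds of everything; $Q_\nu\subseteq Q_\eta$ if $\eta$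 is an initial segment of $\nu$; for each $\eta\in X_{\mathcal H}$ of length $m$, the predicates $Q_{\eta^\frown\langle i\rangle}$, $i<H_m$, partition $Q_\eta$; and whenever $\eta_0,\dots,\eta_{k-1}\in X_{\mathcal H}$, $n<\min_j\operatorname{lgn}(\eta_j)$ and $(\eta_0(n),\dots,\eta_{k-1}(n))\notin E_n$, then $Q_{\eta_0}(x_0)\wedge\dots\wedge Q_{\eta_{k-1}}(x_{k-1})\Rightarrow\neg R(x_0,\dots,x_{k-1})$. A \emph{model completion} of a theory $T_0$ is a theory $T$ in the same language that implies $T_0$, such that every model of $T_0$ embeds in a model of $T$, and for every model $M$ of $T_0$ the theory $T\cup\operatorname{Diag}(M)$ is complete. For a theory $T$ and a formula $\varphi(\bar x,\bar y)$ let $\mathcal P$ be the set of complete types $p(\bar y)$ of $T$ over $\emptyset$ containing $\exists\bar x\,\varphi(\bar x,\bar y)$. The pair $(T,\varphi)$ is \emph{1167-like} if $T$ is countable and one can assign to each $p\in\mathcal P$ a function $f_p:\omega\to\omega$ such that: (i) (continuity) for every $p\in\mathcal P$ and $m<\omega$ there is $\psi(\bar y)\in p$ such that $f_q(m)=f_p(m)$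 for all $q\in\mathcal P$ with $\psi\in q$; (ii) for every $s\ge1$ there is $n<\omega$ such that, whenever $\bar a_0,\dots,\bar a_{s-1},\bar b_0,\dots,\bar b_{s-1}$ are tuples from a model of $T$ whose types over $\emptyset$ belong to $\mathcal P$, with $f_{\operatorname{tp}(\bar a_\ell)}\upharpoonright n=f_{\operatorname{tp}(\bar b_\ell)}\upharpoonright n$ for all $\ell<s$, if $\{\varphi(\bar x,\bar a_\ell):\ell<s\}$ is a partial type then so is $\{\varphi(\bar x,\bar b_\ell):\ell<s\}$. \textbf{Claim.} Let $\mathcal H$ be a template of arity $k\ge2$. Then $T_0(\mathcal H)$ has a model completion; and if $T$ is the model completion of $T_0(\mathcal H)$ and $\varphi(x;y_0,\dots,y_{k-2})=R(x,y_0,\dots,y_{k-2})$, then $(T,\varphi)$ is 1167-like. -/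

import Mathlib

open FirstOrder FirstOrder.Language

universe u v w

/-- `(V, E)` is a `k`-full hypergraph: on tuples of `k` distinct elements the edge relation is
symmetric, and it holds on every `k`-tuple having fewer than `k` distinct elements. -/
structure IsFullHypergraph {V : Type} {k : ℕ} (E : (Fin k → V) → Prop) : Prop where
  symm : ∀ x : Fin k → V, Function.Injective x → E x → ∀ σ : Equiv.Perm (Fin k), E (x ∘ σ)
  full : ∀ x : Fin k → V, ¬ Function.Injective x → E x

/-- A template of arity `k = d + 1`, where `1 ≤ d` (that is, `2 ≤ k`): a sequence of finite
`k`-full hypergraphs with vertex sets `{0, …, size n - 1}` and edge relations `edge n`, together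
with a function `f : ℕ → ℕ \ {0}` that tends to infinity. -/
structure Template (d : ℕ) where
  one_le : 1 ≤ d
  size : ℕ → ℕ
  edge : ∀ n, (Fin (d + 1) → Fin (size n)) → Prop
  f : ℕ → ℕ
  f_pos : ∀ n, 0 < f n
  f_tendsto : ∀ N, ∃ n, ∀ m, n ≤ m → N ≤ f m
  isFull : ∀ n, IsFullHypergraph (edge n)
  f_le_size : ∀ n, f n ≤ size n
  /-- Extension: any `f n` many `(k - 1)`-tuples have a common neighbour. -/
  extension : ∀ (n : ℕ) (i : Fin (f n) → Fin d → Fin (size n)),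
    ∃ s : Fin (size n), ∀ l, edge n (Fin.cons s (i l))

namespace Template

variable {d : ℕ} (H : Template d)

/-- The nodes of length `m` of the tree of `H`: sequences `η` of length `m` with
`η(n) < size n` for `n < m`. -/
abbrev Node (m : ℕ) : Type := (n : Fin m) → Fin (H.size n)

/-- `η` is an initial segment of `ν`. -/
def IsPrefix {m m' : ℕ} (η : H.Node m) (ν : H.Node m') : Prop :=
  ∃ h : m ≤ m', ∀ n : Fin m, η n = ν (Fin.castLE h n)

/-- `η` followed by the one further entry `i`. -/
def snoc {m : ℕ} (η : H.Node m) (i : Fin (H.size m)) : H.Node (m + 1) :=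
  Fin.snoc (α := fun n : Fin (m + 1) => Fin (H.size n)) η i

/-- The relation symbols: a `k`-ary `R` and a unary `Q_η` for each node `η` (of any length). -/
inductive Rel : ℕ → Type
  | R : Rel (d + 1)
  | Q {m : ℕ} (η : H.Node m) : Rel 1

/-- The language of `H`; it has no function symbols. -/
def lang : FirstOrder.Language.{0, 0} where
  Functions := fun _ => Empty
  Relations := H.Rel

/-- The symbol `R`, as a relation symbol of the language. -/
def symR : H.lang.Relations (d + 1) := Rel.R

/-- The symbol `Q_η`, as a relation symbol of the language. -/
def symQ {m : ℕ} (η : H.Node m) : H.lang.Relations 1 := Rel.Q η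

/-- The atomic formula `Q_η(x_i)` in the variables `x_0, …, x_{n-1}`. -/
def atomQ {m n : ℕ} (η : H.Node m) (i : Fin n) : H.lang.BoundedFormula Empty n :=
  (H.symQ η).boundedFormula fun _ => &i

/-- The atomic formula `R(x_{t 0}, …, x_{t (k-1)})` in the variables `x_0, …, x_{n-1}`. -/
def atomR {n : ℕ} (t : Fin (d + 1) → Fin n) : H.lang.BoundedFormula Empty n :=
  H.symR.boundedFormula fun j => &(t j)

/-- The axioms of the universal theory `T₀(H)`. -/
inductive Axiom₀ : H.lang.Sentence → Prop
  /-- `R` holds only on tuples of distinct elements. -/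
  | irrefl (i j : Fin (d + 1)) (hij : i ≠ j) :
      Axiom₀ (H.atomR id ⟹ ∼((&i : H.lang.Term (Empty ⊕ Fin (d + 1))) =' &j)).alls
  /-- `R` is symmetric. -/
  | symm (σ : Equiv.Perm (Fin (d + 1))) :
      Axiom₀ (H.atomR id ⟹ H.atomR σ).alls
  /-- `Q_⟨⟩` names everything. -/
  | root (η : H.Node 0) :
      Axiom₀ (H.atomQ η (0 : Fin 1)).alls
  /-- `Q_ν` refines `Q_η` when `η` is an initial segment of `ν`. -/
  | refine {m m' : ℕ} (η : H.Node m) (ν : H.Node m') (h : H.IsPrefix η ν) :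
      Axiom₀ (H.atomQ ν (0 : Fin 1) ⟹ H.atomQ η 0).alls
  /-- The immediate successors of `η` name disjoint sets. -/
  | disjoint {m : ℕ} (η : H.Node m) (i j : Fin (H.size m)) (hij : i ≠ j) :
      Axiom₀ (∼(H.atomQ (H.snoc η i) (0 : Fin 1) ⊓ H.atomQ (H.snoc η j) 0)).alls
  /-- The immediate successors of `η` cover `Q_η`. -/
  | cover {m : ℕ} (η : H.Node m) :
      Axiom₀ (H.atomQ η (0 : Fin 1) ⟹
        BoundedFormula.iSup fun i : Fin (H.size m) => H.atomQ (H.snoc η i) 0).alls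
  /-- If `⟨η_0(n), …, η_{k-1}(n)⟩` is not an edge of the `n`-th hypergraph, then `R` has no edge
  across `Q_{η_0}, …, Q_{η_{k-1}}`. -/
  | forbid (m : Fin (d + 1) → ℕ) (η : ∀ j, H.Node (m j)) (n : ℕ) (hn : ∀ j, n < m j)
      (h : ¬ H.edge n fun j => η j ⟨n, hn j⟩) :
      Axiom₀ ((BoundedFormula.iInf fun j => H.atomQ (η j) j) ⟹ ∼(H.atomR id)).alls

/-- The universal theory `T₀(H)`. -/
def T₀ : H.lang.Theory := {σ | H.Axiom₀ σ}

/-- The formula `φ(x; y_0, …, y_{k-2}) = R(x, y_0, …, y_{k-2})`. -/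
def edgeFormula : H.lang.Formula (Fin 1 ⊕ Fin d) :=
  H.symR.formula (Fin.cons (Term.var (Sum.inl 0)) fun i => Term.var (Sum.inr i))

end Template

section ModelTheory

variable {L : FirstOrder.Language.{u, v}}

/-- `T'` is a model completion of `T`: it implies `T`, every model of `T` embeds in a model of
`T'`, and for every model `M` of `T` the theory `T'` together with the diagram of `M` is complete,
i.e. any two models of `T'` that extend `M` satisfy the same formulas with parameters from `M`. -/
structure IsModelCompletion (T T' : L.Theory) : Prop where
  models : ∀ σ ∈ T, T' ⊨ᵇ σ
  embeds : ∀ M : T.ModelType.{u, v, w}, ∃ N : T'.ModelType.{u, v, w}, Nonempty (M ↪[L] N)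
  complete : ∀ (M : T.ModelType.{u, v, w}) (N₁ N₂ : T'.ModelType.{u, v, w})
    (e₁ : M ↪[L] N₁) (e₂ : M ↪[L] N₂) (n : ℕ) (φ : L.Formula (Fin n)) (a : Fin n → M),
    φ.Realize (e₁ ∘ a) ↔ φ.Realize (e₂ ∘ a)

/-- The formula `∃ x̄ φ(x̄, ȳ)`. -/
noncomputable def exFormula {p q : ℕ} (φ : L.Formula (Fin p ⊕ Fin q)) : L.Formula (Fin q) :=
  Formula.iExs (Fin p) (φ.relabel Sum.swap : L.Formula (Fin q ⊕ Fin p))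

/-- The set `𝒫` of complete types `p(ȳ)` over the empty set that contain `∃ x̄ φ(x̄, ȳ)`. -/
def typesP (T : L.Theory) {p q : ℕ} (φ : L.Formula (Fin p ⊕ Fin q)) :
    Set (T.CompleteType (Fin q)) :=
  {r | Formula.equivSentence (exFormula φ) ∈ r}

/-- The finite set of instances `{φ(x̄, a_l) : l < s}`, with parameters in the model `M`, is a
partial type. (As it is finite, being finitely satisfiable in `M` means being satisfied in `M`.) -/
def IsPartialType {M : Type w} [L.Structure M] {p q s : ℕ} (φ : L.Formula (Fin p ⊕ Fin q))
    (a : Fin s → Fin q → M) : Prop :=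
  ∃ x : Fin p → M, ∀ l, φ.Realize (Sum.elim x (a l))

/-- `(T, φ(x̄, ȳ))` is 1167-like. Only the values of `f` on `𝒫` matter. The parameters range over
all models of `T`, in place of one large model in which these embed. Countability of the language
gives that of every set of its sentences, so of `T`. -/
def Is1167Like (T : L.Theory) {p q : ℕ} (φ : L.Formula (Fin p ⊕ Fin q)) : Prop :=
  L.card ≤ Cardinal.aleph0 ∧
  ∃ f : T.CompleteType (Fin q) → ℕ → ℕ,
    (∀ r ∈ typesP T φ, ∀ m : ℕ, ∃ ψ : L.Formula (Fin q), Formula.equivSentence ψ ∈ r ∧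
      ∀ r' ∈ typesP T φ, Formula.equivSentence ψ ∈ r' → f r' m = f r m) ∧
    ∀ s : ℕ, 1 ≤ s → ∃ n : ℕ,
      ∀ (M : T.ModelType.{u, v, w}) (a b : Fin s → Fin q → M),
        (∀ l, T.typeOf (a l) ∈ typesP T φ) → (∀ l, T.typeOf (b l) ∈ typesP T φ) →
        (∀ l, ∀ i < n, f (T.typeOf (a l)) i = f (T.typeOf (b l)) i) →
        IsPartialType φ a → IsPartialType φ b

end ModelTheory

/-! A model of `T₀` is the same thing as a `k`-uniform hypergraph whose vertices carry branches of
the tree, with edges only where every `H.edge n` allows them. Call it rich if every finite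
admissible link is realized by a new vertex. The crux is that admissibility is a condition on
finitely many levels. Once `r ^ d ≤ H.f n` for all `n ≥ m`, Extension finds at each such level one
value joined to all `d`-tuples from `r` vertices, so only the levels below `m` can obstruct. Hence
richness is first order. Every model of `T₀` embeds in a rich one, its free closure under adding
vertices with prescribed links (`FreeExt.isRich`). Between rich models, agreement on equality, `R`
and enough levels of the branches survives adding a point (`Sim.exists_option`), so a formula
depends only on such data (`exists_level`). Thus `richTheory` is a model completion. Any model
completion `T` has only rich models (`isRich_of_isModelCompletion`). Let `f_p(m)` code the nodes of
length `m` of a tuple realizing `p`. A common neighbour of `s` tuples `a_l` has a node of length `m`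
admissible also for tuples `b_l` agreeing with the `a_l` below `m`. For `m` large in terms of `s *
d`, richness then yields a common neighbour of the `b_l`. -/

namespace Template

variable {d : ℕ} (H : Template d)

/-- The structure `N`, whose elements `x` are assigned branches `β x` of the tree of `H`, is a
`k`-uniform hypergraph with edges only across tuples of branches which all `H.edge n` allow, and
`Q_η` names the set of elements whose branch extends `η`. -/
structure IsBranched (N : Type*) [H.lang.Structure N] (β : N → ∀ n, Fin (H.size n)) : Prop where
  injective : ∀ x : Fin (d + 1) → N, Structure.RelMap H.symR x → Function.Injective x
  perm : ∀ (x : Fin (d + 1) → N) (σ : Equiv.Perm (Fin (d + 1))),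
    Structure.RelMap H.symR x → Structure.RelMap H.symR (x ∘ σ)
  node_iff : ∀ {m : ℕ} (η : H.Node m) (x : N),
    Structure.RelMap (H.symQ η) (fun _ => x) ↔ ∀ i : Fin m, β x i = η i
  edge : ∀ x : Fin (d + 1) → N, Structure.RelMap H.symR x → ∀ n, H.edge n fun j => β (x j) n

variable {H}

/-- Symmetry is only postulated for distinct entries; all other tuples are edges anyway. The general
form is needed because distinct vertices may share a branch entry. -/
theorem edge_perm {n : ℕ} {x : Fin (d + 1) → Fin (H.size n)} (h : H.edge n x)
    (σ : Equiv.Perm (Fin (d + 1))) : H.edge n (x ∘ σ) := by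
  by_cases hx : Function.Injective x
  · exact (H.isFull n).symm x hx h σ
  · refine (H.isFull n).full _ fun h' => hx ?_
    simpa [Function.comp_assoc] using h'.comp σ.symm.injective

/-! ### Models of `T₀` as hypergraphs with branches -/

section Models

variable {N : Type*} [H.lang.Structure N]

theorem realize_atomQ {m n : ℕ} (η : H.Node m) (i : Fin n) (v : Empty → N) (x : Fin n → N) :
    (H.atomQ η i).Realize v x ↔ Structure.RelMap (H.symQ η) (fun _ => x i) := Iff.rfl

theorem realize_atomR {n : ℕ} (t : Fin (d + 1) → Fin n) (v : Empty → N) (x : Fin n → N) :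
    (H.atomR t).Realize v x ↔ Structure.RelMap H.symR (x ∘ t) := Iff.rfl

theorem realize_alls {n : ℕ} (φ : H.lang.BoundedFormula Empty n) :
    N ⊨ φ.alls ↔ ∀ x : Fin n → N, φ.Realize default x :=
  BoundedFormula.realize_alls

theorem IsBranched.model_T₀ {β : N → ∀ n, Fin (H.size n)} (h : H.IsBranched N β) :
    N ⊨ H.T₀ := by
  refine ⟨fun σ hσ => ?_⟩
  cases hσ with
  | irrefl i j hij =>
    rw [realize_alls]
    intro x
    simp only [BoundedFormula.realize_imp, BoundedFormula.realize_not, realize_atomR]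
    intro hx e
    exact hij (h.injective _ hx e)
  | symm σ =>
    rw [realize_alls]
    intro x
    simp only [BoundedFormula.realize_imp, realize_atomR]
    exact h.perm _ σ
  | root η =>
    rw [realize_alls]
    intro x
    rw [realize_atomQ, h.node_iff]
    exact fun i => i.elim0
  | refine η ν hην =>
    rw [realize_alls]
    intro x
    simp only [BoundedFormula.realize_imp, realize_atomQ, h.node_iff]
    obtain ⟨hm, e⟩ := hην
    intro hx i
    rw [e i]
    exact hx (Fin.castLE hm i)
  | @disjoint m η i j hij =>
    rw [realize_alls]
    intro x
    simp only [BoundedFormula.realize_not, BoundedFormula.realize_inf, realize_atomQ, h.node_iff]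
    rintro ⟨h1, h2⟩
    have h1 := h1 (Fin.last m)
    have h2 := h2 (Fin.last m)
    simp only [snoc, Fin.snoc_last] at h1 h2
    exact hij (h1.symm.trans h2)
  | @cover m η =>
    rw [realize_alls]
    intro x
    simp only [BoundedFormula.realize_imp, BoundedFormula.realize_iSup, realize_atomQ, h.node_iff]
    intro hx
    refine ⟨β (x 0) m, fun i => ?_⟩
    induction i using Fin.lastCases with
    | last => simp [snoc]
    | cast i => simpa [snoc] using hx i
  | forbid m η n hn hE =>
    rw [realize_alls]
    intro x
    simp only [BoundedFormula.realize_imp, BoundedFormula.realize_iInf, realize_atomQ, h.node_iff,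
      BoundedFormula.realize_not, realize_atomR]
    intro hx hR
    apply hE
    convert h.edge _ hR n using 2 with j
    exact (hx j ⟨n, hn j⟩).symm

/-- By the covering, disjointness and refinement axioms each vertex has exactly one node of each
length, and these nodes cohere. Entry `n` of the branch is the last entry of the node of length `n +
1`. -/
theorem exists_isBranched (h : N ⊨ H.T₀) : ∃ β, H.IsBranched N β := by
  have ax : ∀ {n} {φ : H.lang.BoundedFormula Empty n}, H.Axiom₀ φ.alls →
      ∀ x : Fin n → N, φ.Realize default x :=
    fun hφ => (realize_alls _).1 (h.realize_of_mem _ hφ)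
  have refine' : ∀ {m m' : ℕ} (η : H.Node m) (ν : H.Node m') (x : N), H.IsPrefix η ν →
      Structure.RelMap (H.symQ ν) (fun _ => x) → Structure.RelMap (H.symQ η) (fun _ => x) := by
    intro m m' η ν x hp
    exact ax (.refine η ν hp) fun _ => x
  have snoc_eq : ∀ {m : ℕ} (ν : H.Node (m + 1)), H.snoc (fun i => ν i.castSucc) (ν (Fin.last m)) = ν :=
    fun ν => Fin.snoc_init_self ν
  have uniq : ∀ (m : ℕ) (η ν : H.Node m) (x : N), Structure.RelMap (H.symQ η) (fun _ => x) →
      Structure.RelMap (H.symQ ν) (fun _ => x) → η = ν := by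
    intro m
    induction m with
    | zero => intro η ν x _ _; exact Subsingleton.elim _ _
    | succ m ih =>
      intro η ν x hη hν
      have e : (fun i : Fin m => η i.castSucc) = fun i : Fin m => ν i.castSucc :=
        ih _ _ x (refine' _ η x ⟨m.le_succ, fun i => rfl⟩ hη)
          (refine' _ ν x ⟨m.le_succ, fun i => rfl⟩ hν)
      by_contra hne
      have hne' : η (Fin.last m) ≠ ν (Fin.last m) := fun e' => hne <| by
        rw [← snoc_eq η, ← snoc_eq ν, e, e']
      have := ax (.disjoint (fun i : Fin m => η i.castSucc) _ _ hne') fun _ => x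
      rw [BoundedFormula.realize_not, BoundedFormula.realize_inf, realize_atomQ, realize_atomQ,
        snoc_eq η, e, snoc_eq ν] at this
      exact this ⟨hη, hν⟩
  have exist : ∀ (x : N) (m : ℕ), ∃ η : H.Node m, Structure.RelMap (H.symQ η) (fun _ => x) := by
    intro x m
    induction m with
    | zero => exact ⟨_, ax (.root fun i => i.elim0) fun _ => x⟩
    | succ m ih =>
      obtain ⟨η, hη⟩ := ih
      have := ax (.cover η) fun _ => x
      rw [BoundedFormula.realize_imp, BoundedFormula.realize_iSup] at this
      obtain ⟨i, hi⟩ := this hη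
      exact ⟨_, hi⟩
  choose node hnode using exist
  have node_apply : ∀ (x : N) (m : ℕ) (i : Fin m),
      node x (i + 1) (Fin.last i) = node x m i := by
    intro x m i
    have := uniq _ _ (fun j : Fin (i + 1) => node x m (Fin.castLE i.2 j)) x (hnode x (i + 1))
      (refine' _ (node x m) x ⟨i.2, fun j => rfl⟩ (hnode x m))
    exact congrFun this (Fin.last i)
  have nodeIff : ∀ {m : ℕ} (η : H.Node m) (x : N), Structure.RelMap (H.symQ η) (fun _ => x) ↔
      ∀ i : Fin m, node x (i + 1) (Fin.last i) = η i := by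
    intro m η x
    refine ⟨fun hη i => ?_, fun hη => ?_⟩
    · rw [node_apply, uniq m _ η x (hnode x m) hη]
    · have : node x m = η := funext fun i => by rw [← hη i, node_apply]
      exact this ▸ hnode x m
  refine ⟨fun x n => node x (n + 1) (Fin.last n), ?_, ?_, nodeIff, ?_⟩
  · intro x hx i j hij
    by_contra hne
    have := ax (.irrefl i j hne) x
    rw [BoundedFormula.realize_imp, BoundedFormula.realize_not] at this
    exact this hx hij
  · intro x σ hx
    exact ax (.symm σ) x hx
  · intro x hx n
    by_contra hE
    have := ax (.forbid (fun _ => n + 1) (fun j => node (x j) (n + 1)) n (fun _ => n.lt_succ_self)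
      hE) x
    rw [BoundedFormula.realize_imp, BoundedFormula.realize_iInf, BoundedFormula.realize_not] at this
    exact this (fun j => hnode (x j) (n + 1)) hx

end Models

end Template

/-! ### Admissible links and richness -/

namespace Template

variable {d : ℕ} (H : Template d)

/-- A vertex in `Q_ν` may have `S` as its link on vertices `x_i` in `Q_{η_i}`, as far as the levels
below `m` are concerned. -/
structure IsLink {r m : ℕ} (η : Fin r → H.Node m) (ν : H.Node m) (S : Set (Fin d → Fin r)) :
    Prop where
  injective : ∀ t ∈ S, Function.Injective t
  perm : ∀ t ∈ S, ∀ σ : Equiv.Perm (Fin d), t ∘ σ ∈ S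
  edge : ∀ t ∈ S, ∀ n : Fin m, H.edge n (Fin.cons (ν n) fun j => η (t j) n)

/-- From the level `m` on, the extension property of `H` applies to all `d`-tuples from a set of
size `r`. -/
def Bounds (r m : ℕ) : Prop := ∀ n, m ≤ n → r ^ d ≤ H.f n

/-- Every admissible link on finitely many vertices is realized. -/
def IsRich (N : Type*) [H.lang.Structure N] (β : N → ∀ n, Fin (H.size n)) : Prop :=
  ∀ r m : ℕ, H.Bounds r m → ∀ x : Fin r → N, Function.Injective x →
    ∀ (ν : H.Node m) (S : Set (Fin d → Fin r)), H.IsLink (fun i n => β (x i) n) ν S →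
      ∃ y, (∀ i, y ≠ x i) ∧ (∀ n : Fin m, β y n = ν n) ∧
        ∀ t : Fin d → Fin r, Structure.RelMap H.symR (Fin.cons y (x ∘ t) : Fin (d + 1) → N) ↔ t ∈ S

open Classical in
/-- The last variable lies in `Q_ν`, differs from the others and has the link `S` on them. -/
noncomputable def linkFormula {r m : ℕ} (ν : H.Node m) (S : Set (Fin d → Fin r)) :
    H.lang.BoundedFormula Empty (r + 1) :=
  H.atomQ ν (Fin.last r) ⊓
    ((BoundedFormula.iInf fun i : Fin r =>
      ∼((&(Fin.last r) : H.lang.Term (Empty ⊕ Fin (r + 1))) =' &i.castSucc)) ⊓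
    BoundedFormula.iInf fun t : Fin d → Fin r =>
      if t ∈ S then H.atomR (Fin.cons (Fin.last r) (Fin.castSucc ∘ t))
      else ∼(H.atomR (Fin.cons (Fin.last r) (Fin.castSucc ∘ t))))

/-- The variables are distinct and lie in the sets named by `η`. -/
noncomputable def positionFormula {r m : ℕ} (η : Fin r → H.Node m) :
    H.lang.BoundedFormula Empty r :=
  (BoundedFormula.iInf fun i => H.atomQ (η i) i) ⊓
    BoundedFormula.iInf fun p : {p : Fin r × Fin r // p.1 ≠ p.2} =>
      ∼((&p.1.1 : H.lang.Term (Empty ⊕ Fin r)) =' &p.1.2)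

/-- Distinct vertices in the sets named by `η` have a further vertex in `Q_ν` with link `S`. -/
noncomputable def linkSentence {r m : ℕ} (η : Fin r → H.Node m) (ν : H.Node m)
    (S : Set (Fin d → Fin r)) : H.lang.Sentence :=
  (H.positionFormula η ⟹ ∃' (H.linkFormula ν S)).alls

/-- The theory `T₀(H)` together with the existence of all admissible links. -/
def richTheory : H.lang.Theory :=
  H.T₀ ∪ {σ | ∃ (r m : ℕ) (η : Fin r → H.Node m) (ν : H.Node m) (S : Set (Fin d → Fin r)),
    H.Bounds r m ∧ H.IsLink η ν S ∧ σ = H.linkSentence η ν S}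

variable {H}

theorem exists_bounds (r : ℕ) : ∃ m, H.Bounds r m := H.f_tendsto (r ^ d)

theorem Bounds.mono {r r' m m' : ℕ} (h : H.Bounds r m) (hr : r' ≤ r) (hm : m ≤ m') :
    H.Bounds r' m' :=
  fun n hn => (Nat.pow_le_pow_left hr d).trans (h n (hm.trans hn))

/-- Finitely many tuples have a common neighbour in `H.edge n`, if there are at most `H.f n`. -/
theorem exists_common_neighbour {ι : Type*} [Fintype ι] {n : ℕ} (h : Fintype.card ι ≤ H.f n)
    (i : ι → Fin d → Fin (H.size n)) : ∃ s, ∀ l, H.edge n (Fin.cons s (i l)) := by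
  have h0 : 0 < H.size n := (H.f_pos n).trans_le (H.f_le_size n)
  let e := Fintype.equivFin ι
  -- Extension speaks of exactly `H.f n` tuples, so the family is padded with constant tuples.
  obtain ⟨s, hs⟩ := H.extension n fun l =>
    if hl : (l : ℕ) < Fintype.card ι then i (e.symm ⟨l, hl⟩) else fun _ => ⟨0, h0⟩
  refine ⟨s, fun l => ?_⟩
  have := hs ⟨e l, (e l).2.trans_le h⟩
  simpa using this

/-- A branch admissible for a link up to a sufficiently high level extends to one which is
admissible at all levels. -/
theorem exists_branch {r m : ℕ} (hm : H.Bounds r m) (β : Fin r → ∀ n, Fin (H.size n))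
    (ν : H.Node m) (S : Set (Fin d → Fin r))
    (hS : ∀ t ∈ S, ∀ n : Fin m, H.edge n (Fin.cons (ν n) fun j => β (t j) n)) :
    ∃ b : ∀ n, Fin (H.size n), (∀ n : Fin m, b n = ν n) ∧
      ∀ t ∈ S, ∀ n, H.edge n (Fin.cons (b n) fun j => β (t j) n) := by
  have key : ∀ n, ∃ s : Fin (H.size n), (∀ h : n < m, s = ν ⟨n, h⟩) ∧
      ∀ t ∈ S, H.edge n (Fin.cons s fun j => β (t j) n) := by
    intro n
    -- Below `m` the node `ν` decides; from `m` on, Extension handles all `r ^ d` tuples at once,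
    -- whether in `S` or not.
    by_cases h : n < m
    · exact ⟨ν ⟨n, h⟩, fun _ => rfl, fun t ht => hS t ht ⟨n, h⟩⟩
    · obtain ⟨s, hs⟩ := exists_common_neighbour (H := H) (n := n) (ι := Fin d → Fin r)
        (by simpa using hm n (not_lt.1 h)) fun t j => β (t j) n
      exact ⟨s, fun h' => absurd h' h, fun t _ => hs t⟩
  choose b hb hb' using key
  exact ⟨b, fun n => hb n n.2, fun t ht n => hb' n t ht⟩

section Models

variable {N : Type*} [H.lang.Structure N]

theorem realize_linkFormula {r m : ℕ} (ν : H.Node m) (S : Set (Fin d → Fin r)) (v : Empty → N)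
    (x : Fin r → N) (y : N) :
    (H.linkFormula ν S).Realize v (Fin.snoc x y : Fin (r + 1) → N) ↔
      Structure.RelMap (H.symQ ν) (fun _ => y) ∧ (∀ i, y ≠ x i) ∧ ∀ t : Fin d → Fin r,
        (Structure.RelMap H.symR (Fin.cons y (x ∘ t) : Fin (d + 1) → N) ↔ t ∈ S) := by
  have e : ∀ t : Fin d → Fin r, (Fin.snoc x y : Fin (r + 1) → N) ∘
      (Fin.cons (Fin.last r) (Fin.castSucc ∘ t) : Fin (d + 1) → Fin (r + 1)) =
        Fin.cons y (x ∘ t) := by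
    intro t
    funext j
    cases j using Fin.cases <;> simp
  rw [linkFormula, BoundedFormula.realize_inf, BoundedFormula.realize_inf,
    BoundedFormula.realize_iInf, BoundedFormula.realize_iInf, realize_atomQ, Fin.snoc_last]
  refine and_congr_right fun _ => and_congr ?_ ?_
  · refine forall_congr' fun i => ?_
    rw [BoundedFormula.realize_not, BoundedFormula.realize_bdEqual]
    simp
  · refine forall_congr' fun t => ?_
    split_ifs with ht
    · rw [realize_atomR, e]
      simp [ht]
    · rw [BoundedFormula.realize_not, realize_atomR, e]
      simp [ht]

theorem realize_positionFormula {r m : ℕ} (η : Fin r → H.Node m) (v : Empty → N) (x : Fin r → N) :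
    (H.positionFormula η).Realize v x ↔
      (∀ i, Structure.RelMap (H.symQ (η i)) (fun _ => x i)) ∧ Function.Injective x := by
  rw [positionFormula, BoundedFormula.realize_inf, BoundedFormula.realize_iInf,
    BoundedFormula.realize_iInf]
  refine and_congr Iff.rfl ⟨fun h i j hij => ?_, fun h p => ?_⟩
  · by_contra hne
    have := h ⟨(i, j), hne⟩
    rw [BoundedFormula.realize_not, BoundedFormula.realize_bdEqual] at this
    exact this hij
  · rw [BoundedFormula.realize_not, BoundedFormula.realize_bdEqual]
    exact fun e => p.2 (h e)

theorem realize_linkSentence {β : N → ∀ n, Fin (H.size n)} (hβ : H.IsBranched N β) {r m : ℕ}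
    (η : Fin r → H.Node m) (ν : H.Node m) (S : Set (Fin d → Fin r)) :
    N ⊨ H.linkSentence η ν S ↔ ∀ x : Fin r → N, Function.Injective x →
      (∀ (i : Fin r) (n : Fin m), β (x i) n = η i n) →
        ∃ y, (∀ i, y ≠ x i) ∧ (∀ n : Fin m, β y n = ν n) ∧ ∀ t : Fin d → Fin r,
          (Structure.RelMap H.symR (Fin.cons y (x ∘ t) : Fin (d + 1) → N) ↔ t ∈ S) := by
  rw [linkSentence, realize_alls]
  refine forall_congr' fun x => ?_
  simp only [BoundedFormula.realize_imp, realize_positionFormula, BoundedFormula.realize_ex,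
    realize_linkFormula, hβ.node_iff]
  constructor
  · intro h hx hη
    obtain ⟨y, h1, h2, h3⟩ := h ⟨hη, hx⟩
    exact ⟨y, h2, h1, h3⟩
  · rintro h ⟨hη, hx⟩
    obtain ⟨y, h1, h2, h3⟩ := h hx hη
    exact ⟨y, h2, h1, h3⟩

theorem IsRich.model {β : N → ∀ n, Fin (H.size n)} (hβ : H.IsBranched N β) (h : H.IsRich N β) :
    N ⊨ H.richTheory := by
  refine ⟨fun σ hσ => ?_⟩
  rcases hσ with hσ | ⟨r, m, η, ν, S, hm, hS, rfl⟩
  · exact hβ.model_T₀.realize_of_mem σ hσ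
  · rw [realize_linkSentence hβ]
    intro x hx hη
    have : (fun (i : Fin r) (n : Fin m) => β (x i) n) = η := funext fun i => funext fun n => hη i n
    exact h r m hm x hx ν S (this ▸ hS)

theorem isRich_of_model {β : N → ∀ n, Fin (H.size n)} (hβ : H.IsBranched N β)
    (h : N ⊨ H.richTheory) : H.IsRich N β := by
  intro r m hm x hx ν S hS
  exact (realize_linkSentence hβ _ ν S).1 (h.realize_of_mem _ (Or.inr ⟨r, m, _, ν, S, hm, hS, rfl⟩))
    x hx fun i n => rfl

/-- Richness freed from an injective enumeration, for use with tuples that may repeat entries. -/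
theorem IsRich.exists_of_finite {β : N → ∀ n, Fin (H.size n)} (h : H.IsRich N β) {A : Set N}
    (hA : A.Finite) {m : ℕ} (hm : H.Bounds A.ncard m) (ν : H.Node m) (S : Set (Fin d → N))
    (inj : ∀ s ∈ S, Function.Injective s) (perm : ∀ s ∈ S, ∀ σ : Equiv.Perm (Fin d), s ∘ σ ∈ S)
    (edge : ∀ s ∈ S, ∀ n : Fin m, H.edge n (Fin.cons (ν n) fun j => β (s j) n)) :
    ∃ y ∉ A, (∀ n : Fin m, β y n = ν n) ∧ ∀ s : Fin d → N, (∀ j, s j ∈ A) →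
      (Structure.RelMap H.symR (Fin.cons y s : Fin (d + 1) → N) ↔ s ∈ S) := by
  have := hA.to_subtype
  let e : Fin A.ncard ≃ A := (Finite.equivFinOfCardEq (Nat.card_coe_set_eq A)).symm
  let x : Fin A.ncard → N := fun i => e i
  obtain ⟨y, hy, hν, hR⟩ := h A.ncard m hm x (Subtype.val_injective.comp e.injective) ν
    {t | x ∘ t ∈ S} ⟨fun t ht => (inj _ ht).of_comp, fun t ht σ => perm _ ht σ,
      fun t ht n => edge _ ht n⟩
  refine ⟨y, fun hyA => hy (e.symm ⟨y, hyA⟩) (by simp [x]), hν, fun s hs => ?_⟩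
  have es : x ∘ (fun j => e.symm ⟨s j, hs j⟩) = s := by
    funext j
    simp [x]
  have := hR fun j => e.symm ⟨s j, hs j⟩
  rw [Set.mem_ofPred_eq, es] at this
  exact this

end Models

end Template

/-! ### The free closure: embedding a model of `T₀` in a rich one -/

namespace Template

variable {d : ℕ} (H : Template d)

/-- The free closure of `M` under adding, for finitely many vertices `p i`, a new vertex in `Q_ν`
with link `S` on them. -/
inductive FreeExt (M : Type w) : Type w
  | base : M → FreeExt M
  | new {r : ℕ} (p : Fin r → FreeExt M) {m : ℕ} (ν : H.Node m) (S : Set (Fin d → Fin r)) : FreeExt M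

theorem exists_perm_succ {n : ℕ} (σ : Equiv.Perm (Fin (n + 1))) (h : σ 0 = 0) :
    ∃ τ : Equiv.Perm (Fin n), ∀ i, σ i.succ = (τ i).succ := by
  have hne : ∀ i : Fin n, σ i.succ ≠ 0 := fun i e => Fin.succ_ne_zero i (σ.injective (e.trans h.symm))
  have inj : Function.Injective fun i : Fin n => (σ i.succ).pred (hne i) := fun i j e =>
    Fin.succ_injective _ (σ.injective (Fin.pred_inj.1 e))
  exact ⟨Equiv.ofBijective _ (Finite.injective_iff_bijective.1 inj), fun i => by simp⟩

namespace FreeExt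

variable {H} {M : Type w}

/-- The number of steps needed to build a vertex. -/
def rank : H.FreeExt M → ℕ
  | base _ => 0
  | new p _ _ => (Finset.univ.sup fun i => rank (p i)) + 1

theorem rank_lt_new {r : ℕ} (p : Fin r → H.FreeExt M) {m : ℕ} (ν : H.Node m)
    (S : Set (Fin d → Fin r)) (i : Fin r) : (p i).rank < (new p ν S).rank := by
  rw [rank]
  exact Nat.lt_succ_of_le (Finset.le_sup (f := fun i => rank (p i)) (Finset.mem_univ i))

instance nonempty_branch : Nonempty (∀ n, Fin (H.size n)) :=
  ⟨fun n => ⟨0, (H.f_pos n).trans_le (H.f_le_size n)⟩⟩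

/-- The branches of the vertices: a new vertex gets a branch admissible for its link. -/
noncomputable def branch (β : M → ∀ n, Fin (H.size n)) : H.FreeExt M → ∀ n, Fin (H.size n)
  | base x => β x
  | new (m := m) p ν S => Classical.epsilon fun b : ∀ n, Fin (H.size n) =>
      (∀ n : Fin m, b n = ν n) ∧ ∀ t ∈ S, ∀ n, H.edge n (Fin.cons (b n) fun j => branch β (p (t j)) n)

/-- The tuple `x` lists an edge, with the vertex added last in front. -/
inductive IsEdge [H.lang.Structure M] : (Fin (d + 1) → H.FreeExt M) → Prop
  | base (x : Fin (d + 1) → M) (hx : Structure.RelMap H.symR x) : IsEdge (base ∘ x)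
  | new {r : ℕ} (p : Fin r → H.FreeExt M) {m : ℕ} (ν : H.Node m) (S : Set (Fin d → Fin r))
      (t : Fin d → Fin r) (ht : t ∈ S) : IsEdge (Fin.cons (new p ν S) (p ∘ t))

/-- The edge relation of the free closure. -/
def Edge [H.lang.Structure M] (β : M → ∀ n, Fin (H.size n)) (x : Fin (d + 1) → H.FreeExt M) :
    Prop :=
  Function.Injective x ∧ (∀ n, H.edge n fun j => branch β (x j) n) ∧
    ∃ σ : Equiv.Perm (Fin (d + 1)), IsEdge (x ∘ σ)

/-- The structure on the free closure of `M`. -/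
@[reducible] noncomputable def struc [H.lang.Structure M] (β : M → ∀ n, Fin (H.size n)) :
    H.lang.Structure (H.FreeExt M) where
  funMap := fun f => Empty.elim f
  RelMap := fun {n} (r : H.Rel n) => match n, r with
    | _, .R => Edge β
    | _, .Q (m := m) η => fun x => ∀ i : Fin m, branch β (x 0) i = η i

theorem base_injective : Function.Injective (base : M → H.FreeExt M) := fun _ _ h => by
  cases h; rfl

variable [H.lang.Structure M]

/-- `Edge` imposes distinctness and all the constraints `H.edge n` by definition, so new vertices
with inadmissible links, whose branches are arbitrary, do no harm. -/
theorem isBranched (β : M → ∀ n, Fin (H.size n)) :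
    letI := struc β
    H.IsBranched (H.FreeExt M) (branch β) := by
  let _ := struc β
  refine ⟨fun x hx => hx.1, fun x σ hx => ?_, fun η x => Iff.rfl, fun x hx => hx.2.1⟩
  obtain ⟨h1, h2, τ, h3⟩ := hx
  refine ⟨h1.comp σ.injective, fun n => edge_perm (h2 n) σ, σ⁻¹ * τ, ?_⟩
  convert h3 using 1
  funext i
  simp

/-- An edge listed by `IsEdge.new` contains a new vertex, so none is added inside `M`. -/
theorem edge_base_iff {β : M → ∀ n, Fin (H.size n)} (hβ : H.IsBranched M β)
    (x : Fin (d + 1) → M) : Edge β (base ∘ x) ↔ Structure.RelMap H.symR x := by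
  constructor
  · rintro ⟨-, -, σ, h⟩
    generalize hy : (base ∘ x) ∘ σ = y at h
    cases h with
    | base z hz =>
      have : x ∘ σ = z := by
        funext i
        exact base_injective (congrFun hy i)
      have := hβ.perm _ σ⁻¹ (this ▸ hz)
      convert this using 1
      funext i
      simp
    | new p ν S t ht =>
      have := congrFun hy 0
      simp at this
  · intro hx
    exact ⟨base_injective.comp (hβ.injective _ hx), hβ.edge _ hx, 1, .base x hx⟩

/-- The embedding of `M` into its free closure. -/
def embedding {β : M → ∀ n, Fin (H.size n)} (hβ : H.IsBranched M β) :
    letI := struc β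
    M ↪[H.lang] H.FreeExt M :=
  letI := struc β
  { toFun := base
    inj' := base_injective
    map_fun' := fun f => Empty.elim f
    map_rel' := by
      intro n r x
      cases r with
      | R => exact edge_base_iff hβ x
      | Q η =>
        have e : x = fun _ => x 0 := funext fun i => by rw [Subsingleton.elim i 0]
        refine Iff.trans ?_ ((hβ.node_iff η (x 0)).symm.trans (by rw [← e]; rfl))
        exact Iff.rfl }

/-- The new vertex has the prescribed link. -/
theorem edge_new_iff {β : M → ∀ n, Fin (H.size n)} {r m : ℕ} (hm : H.Bounds r m)
    (x : Fin r → H.FreeExt M) (hx : Function.Injective x) (ν : H.Node m) (S : Set (Fin d → Fin r))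
    (hS : H.IsLink (fun i n => branch β (x i) n) ν S) :
    (∀ n : Fin m, branch β (new x ν S) n = ν n) ∧
      ∀ t : Fin d → Fin r, Edge β (Fin.cons (new x ν S) (x ∘ t)) ↔ t ∈ S := by
  obtain ⟨h1, h2⟩ : (∀ n : Fin m, branch β (new x ν S) n = ν n) ∧ ∀ t ∈ S, ∀ n,
      H.edge n (Fin.cons (branch β (new x ν S) n) fun j => branch β (x (t j)) n) := by
    rw [branch]
    exact Classical.epsilon_spec (p := fun b : ∀ n, Fin (H.size n) => (∀ n : Fin m, b n = ν n) ∧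
      ∀ t ∈ S, ∀ n, H.edge n (Fin.cons (b n) fun j => branch β (x (t j)) n))
      (exists_branch hm (fun i => branch β (x i)) ν S hS.edge)
  refine ⟨h1, fun t => ⟨?_, fun ht => ⟨?_, fun n => ?_, 1, .new x ν S t ht⟩⟩⟩
  · rintro ⟨hinj, -, σ, h⟩
    generalize hy : (Fin.cons (new x ν S) (x ∘ t) : Fin (d + 1) → H.FreeExt M) ∘ σ = y at h
    cases h with
    | base z hz =>
      have := congrFun hy (σ⁻¹ 0)
      simp at this
    | new p ν' S' t' ht' =>
      have e0 := congrFun hy 0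
      rw [Function.comp_apply, Fin.cons_zero] at e0
      -- If `σ` moved `0`, the two vertices heading the lists would each be among the parameters of
      -- the other, so each would have the smaller rank.
      have h0 : σ 0 = 0 := by
        by_contra hne
        obtain ⟨i, hi⟩ := Fin.exists_succ_eq.2 hne
        have hne' : σ.symm 0 ≠ 0 := fun e => hne (σ.symm_apply_eq.1 e).symm
        obtain ⟨j, hj⟩ := Fin.exists_succ_eq.2 hne'
        have e1 := congrFun hy j.succ
        rw [Function.comp_apply, hj, Equiv.apply_symm_apply, Fin.cons_zero, ← hj, Fin.cons_succ,
          Function.comp_apply] at e1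
        rw [← hi, Fin.cons_succ, Function.comp_apply] at e0
        have l1 := rank_lt_new x ν S (t i)
        have l2 := rank_lt_new p ν' S' (t' j)
        rw [e0, e1] at l1
        exact lt_asymm l1 l2
      obtain ⟨τ, hτ⟩ := exists_perm_succ σ h0
      rw [h0, Fin.cons_zero] at e0
      -- By freeness the heading vertex determines its parameters and its link.
      cases e0
      have e2 : t ∘ τ = t' := by
        funext i
        have := congrFun hy i.succ
        rw [Function.comp_apply, hτ, Fin.cons_succ, Fin.cons_succ] at this
        exact hx this
      have := hS.perm _ ht' τ.symm
      rw [← e2, Function.comp_assoc, Equiv.self_comp_symm, Function.comp_id] at this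
      exact this
  · rw [Fin.cons_injective_iff]
    refine ⟨?_, hx.comp (hS.injective t ht)⟩
    rintro ⟨i, hi⟩
    have := rank_lt_new x ν S (t i)
    rw [← hi] at this
    exact lt_irrefl _ this
  · convert h2 t ht n using 1
    funext j
    cases j using Fin.cases <;> rfl

theorem isRich (β : M → ∀ n, Fin (H.size n)) :
    letI := struc β
    H.IsRich (H.FreeExt M) (branch β) := by
  intro r m hm x hx ν S hS
  obtain ⟨h1, h2⟩ := edge_new_iff hm x hx ν S hS
  refine ⟨new x ν S, fun i e => ?_, h1, h2⟩
  have := rank_lt_new x ν S i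
  rw [← e] at this
  exact lt_irrefl _ this

end FreeExt

end Template

/-! ### Back-and-forth between rich structures -/

namespace Template

variable {d : ℕ} {H : Template d}

section BackAndForth

variable {N₁ N₂ : Type*} [H.lang.Structure N₁] [H.lang.Structure N₂]

/-- The tuples `a` and `b` satisfy the same equalities, instances of `R`, and instances of `Q_η` for
`η` of length at most `m`. -/
structure Sim (β₁ : N₁ → ∀ n, Fin (H.size n)) (β₂ : N₂ → ∀ n, Fin (H.size n)) (m : ℕ) {ι : Type*}
    (a : ι → N₁) (b : ι → N₂) : Prop where
  eq_iff : ∀ i j, a i = a j ↔ b i = b j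
  rel_iff : ∀ t : Fin (d + 1) → ι, Structure.RelMap H.symR (a ∘ t) ↔ Structure.RelMap H.symR (b ∘ t)
  branch_eq : ∀ i, ∀ n < m, β₁ (a i) n = β₂ (b i) n

variable {β₁ : N₁ → ∀ n, Fin (H.size n)} {β₂ : N₂ → ∀ n, Fin (H.size n)} {m : ℕ} {ι : Type*}
  {a : ι → N₁} {b : ι → N₂}

theorem Sim.symm (h : Sim β₁ β₂ m a b) : Sim β₂ β₁ m b a :=
  ⟨fun i j => (h.eq_iff i j).symm, fun t => (h.rel_iff t).symm, fun i n hn => (h.branch_eq i n hn).symm⟩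

theorem Sim.mono (h : Sim β₁ β₂ m a b) {m' : ℕ} (hm : m' ≤ m) : Sim β₁ β₂ m' a b :=
  ⟨h.eq_iff, h.rel_iff, fun i n hn => h.branch_eq i n (hn.trans_le hm)⟩

theorem Sim.comp (h : Sim β₁ β₂ m a b) {κ : Type*} (g : κ → ι) : Sim β₁ β₂ m (a ∘ g) (b ∘ g) :=
  ⟨fun i j => h.eq_iff (g i) (g j), fun t => h.rel_iff (g ∘ t), fun i => h.branch_eq (g i)⟩

theorem Sim.comp_eq_iff (h : Sim β₁ β₂ m a b) {κ : Type*} (s t : κ → ι) :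
    a ∘ s = a ∘ t ↔ b ∘ s = b ∘ t := by
  simp only [funext_iff, Function.comp_apply, h.eq_iff]

theorem relMap_comp_iff (h₁ : H.IsBranched N₁ β₁) (x : Fin (d + 1) → N₁)
    (σ : Equiv.Perm (Fin (d + 1))) :
    Structure.RelMap H.symR (x ∘ σ) ↔ Structure.RelMap H.symR x := by
  refine ⟨fun h => ?_, h₁.perm x σ⟩
  have := h₁.perm _ σ.symm h
  rwa [Function.comp_assoc, Equiv.self_comp_symm, Function.comp_id] at this

theorem Sim.option (h₁ : H.IsBranched N₁ β₁) (h₂ : H.IsBranched N₂ β₂) (h : Sim β₁ β₂ m a b)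
    {x : N₁} {y : N₂} (hx : ∀ i, x ≠ a i) (hy : ∀ i, y ≠ b i) (hxy : ∀ n < m, β₁ x n = β₂ y n)
    (hR : ∀ t : Fin d → ι, Structure.RelMap H.symR (Fin.cons x (a ∘ t) : Fin (d + 1) → N₁) ↔
      Structure.RelMap H.symR (Fin.cons y (b ∘ t) : Fin (d + 1) → N₂)) :
    Sim β₁ β₂ m (fun o : Option ι => o.elim x a) (fun o : Option ι => o.elim y b) := by
  refine ⟨?_, fun t => ?_, ?_⟩
  · rintro (_ | i) (_ | j)
    · simp
    · simp [hx, hy]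
    · simp [(hx i).symm, (hy i).symm]
    · exact h.eq_iff i j
  · by_cases h0 : ∃ j, t j = none
    · obtain ⟨j, hj⟩ := h0
      -- By symmetry the added point may be moved to the front. If it occurs again, `R` fails on
      -- both sides.
      rw [← relMap_comp_iff h₁ _ (Equiv.swap 0 j), ← relMap_comp_iff h₂ _ (Equiv.swap 0 j),
        Function.comp_assoc, Function.comp_assoc]
      have hs : (t ∘ Equiv.swap 0 j) 0 = none := by simpa using hj
      generalize t ∘ Equiv.swap 0 j = s at hs
      by_cases h1 : ∃ i : Fin d, s i.succ = none
      · obtain ⟨i, hi⟩ := h1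
        have key : s i.succ = s 0 := hi.trans hs.symm
        refine iff_of_false (fun hR => ?_) fun hR => ?_
        · exact Fin.succ_ne_zero i (h₁.injective _ hR (by simp [key]))
        · exact Fin.succ_ne_zero i (h₂.injective _ hR (by simp [key]))
      · push Not at h1
        choose s' hs' using fun i => Option.ne_none_iff_exists.1 (h1 i)
        convert hR s' using 2
        · funext i
          cases i using Fin.cases with
          | zero => simp [hs]
          | succ i => simp [← hs']
        · funext i
          cases i using Fin.cases with
          | zero => simp [hs]
          | succ i => simp [← hs']
    · push Not at h0
      choose s hs using fun i => Option.ne_none_iff_exists.1 (h0 i)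
      obtain rfl : (fun i => some (s i)) = t := funext hs
      exact h.rel_iff s
  · rintro (_ | i)
    · exact hxy
    · exact h.branch_eq i

/-- For a new point `x`, its link on `a` is copied to `b`, together with its node of length `m`. The
copy is admissible below `m` because the branches agree there, and richness asks for no more. -/
theorem Sim.exists_option [Finite ι] (h₁ : H.IsBranched N₁ β₁) (h₂ : H.IsBranched N₂ β₂)
    (hr : H.IsRich N₂ β₂) (hm : H.Bounds (Nat.card ι) m) (h : Sim β₁ β₂ m a b) (x : N₁) :
    ∃ y, Sim β₁ β₂ m (fun o : Option ι => o.elim x a) (fun o : Option ι => o.elim y b) := by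
  by_cases hx : ∃ i, x = a i
  · obtain ⟨i, rfl⟩ := hx
    refine ⟨b i, ?_⟩
    convert h.comp fun o : Option ι => o.elim i id using 1
    · funext o; cases o <;> rfl
    · funext o; cases o <;> rfl
  · push Not at hx
    let S : Set (Fin d → N₂) := {s | ∃ t : Fin d → ι, s = b ∘ t ∧
      Structure.RelMap H.symR (Fin.cons x (a ∘ t) : Fin (d + 1) → N₁)}
    have inj : ∀ s ∈ S, Function.Injective s := by
      rintro _ ⟨t, rfl, ht⟩ i j hij
      have := (Fin.cons_injective_iff.1 (h₁.injective _ ht)).2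
      exact this ((h.eq_iff _ _).2 hij)
    have perm : ∀ s ∈ S, ∀ σ : Equiv.Perm (Fin d), s ∘ σ ∈ S := by
      rintro _ ⟨t, rfl, ht⟩ σ
      refine ⟨t ∘ σ, rfl, ?_⟩
      -- This permutation fixes `0` and acts as `σ` on the remaining places.
      have := h₁.perm _ (Equiv.Perm.decomposeFin.symm (0, σ)) ht
      convert this using 1
      funext i
      cases i using Fin.cases <;> simp
    have edge : ∀ s ∈ S, ∀ n : Fin m, H.edge n (Fin.cons (β₁ x n) fun j => β₂ (s j) n) := by
      rintro _ ⟨t, rfl, ht⟩ n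
      convert h₁.edge _ ht n using 1
      funext i
      cases i using Fin.cases with
      | zero => rfl
      | succ i => exact (h.branch_eq (t i) n n.2).symm
    have hb : (Set.range b).ncard ≤ Nat.card ι := by
      rw [← Set.image_univ]
      exact (Set.ncard_image_le Set.finite_univ).trans (Set.ncard_univ ι).le
    obtain ⟨y, hy, hyx, hR⟩ := hr.exists_of_finite (Set.finite_range b) (hm.mono hb le_rfl)
      (fun n => β₁ x n) S inj perm edge
    refine ⟨y, h.option h₁ h₂ hx (fun i e => hy ⟨i, e.symm⟩) (fun n hn => (hyx ⟨n, hn⟩).symm)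
      fun t => ?_⟩
    rw [hR (b ∘ t) fun j => ⟨t j, rfl⟩]
    refine ⟨fun ht => ⟨t, rfl, ht⟩, ?_⟩
    rintro ⟨t', e, ht'⟩
    rwa [(h.comp_eq_iff t t').2 e]

theorem Sim.exists_snoc {α : Type*} [Finite α] {l : ℕ} {v : α → N₁} {v' : α → N₂}
    {xs : Fin l → N₁} {ys : Fin l → N₂} (h₁ : H.IsBranched N₁ β₁) (h₂ : H.IsBranched N₂ β₂)
    (hr : H.IsRich N₂ β₂) (hm : H.Bounds (Nat.card (α ⊕ Fin l)) m)
    (h : Sim β₁ β₂ m (Sum.elim v xs) (Sum.elim v' ys)) (x : N₁) :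
    ∃ y, Sim β₁ β₂ m (Sum.elim v (Fin.snoc xs x : Fin (l + 1) → N₁))
      (Sum.elim v' (Fin.snoc ys y : Fin (l + 1) → N₂)) := by
  obtain ⟨y, hy⟩ := h.exists_option h₁ h₂ hr hm x
  refine ⟨y, ?_⟩
  convert hy.comp (Sum.elim (fun i => some (Sum.inl i))
    (Fin.snoc (α := fun _ => Option (α ⊕ Fin l)) (fun i => some (Sum.inr i)) none)) using 1
  · funext i
    rcases i with i | i
    · rfl
    · cases i using Fin.lastCases <;> simp
  · funext i
    rcases i with i | i
    · rfl
    · cases i using Fin.lastCases <;> simp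

end BackAndForth

theorem term_eq_var {α : Type*} (t : H.lang.Term α) : ∃ i, t = Term.var i := by
  cases t with
  | var i => exact ⟨i, rfl⟩
  | func f => exact Empty.elim f

/-- In rich structures, the truth of a formula only depends on the quantifier-free type up to some
level. -/
theorem exists_level {α : Type*} [Finite α] {l : ℕ} (φ : H.lang.BoundedFormula α l) :
    ∃ m, ∀ (N₁ N₂ : Type w) [H.lang.Structure N₁] [H.lang.Structure N₂]
      (β₁ : N₁ → ∀ n, Fin (H.size n)) (β₂ : N₂ → ∀ n, Fin (H.size n)),
      H.IsBranched N₁ β₁ → H.IsBranched N₂ β₂ → H.IsRich N₁ β₁ → H.IsRich N₂ β₂ →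
      ∀ (v : α → N₁) (v' : α → N₂) (xs : Fin l → N₁) (ys : Fin l → N₂),
        Sim β₁ β₂ m (Sum.elim v xs) (Sum.elim v' ys) → (φ.Realize v xs ↔ φ.Realize v' ys) := by
  induction φ with
  | falsum => exact ⟨0, fun _ _ _ _ _ _ _ _ _ _ _ _ _ _ _ => Iff.rfl⟩
  | equal t₁ t₂ =>
    obtain ⟨i, rfl⟩ := term_eq_var t₁
    obtain ⟨j, rfl⟩ := term_eq_var t₂
    exact ⟨0, fun _ _ _ _ _ _ _ _ _ _ _ _ _ _ h => h.eq_iff i j⟩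
  | rel r ts =>
    choose t ht using fun i => term_eq_var (ts i)
    obtain rfl : ts = fun i => Term.var (t i) := funext ht
    cases r with
    | R => exact ⟨0, fun _ _ _ _ _ _ _ _ _ _ _ _ _ _ h => h.rel_iff t⟩
    | @Q m η =>
      refine ⟨m, fun N₁ N₂ _ _ β₁ β₂ h₁ h₂ _ _ v v' xs ys h => ?_⟩
      have e : ∀ {N : Type w} (g : Fin 1 → N), g = fun _ => g 0 :=
        fun g => funext fun i => by rw [Subsingleton.elim i 0]
      change Structure.RelMap (H.symQ η) (Sum.elim v xs ∘ t) ↔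
        Structure.RelMap (H.symQ η) (Sum.elim v' ys ∘ t)
      rw [e (Sum.elim v xs ∘ t), e (Sum.elim v' ys ∘ t), h₁.node_iff, h₂.node_iff]
      exact forall_congr' fun i => by
        rw [Function.comp_apply, Function.comp_apply, h.branch_eq _ _ i.2]
  | imp φ ψ ih₁ ih₂ =>
    obtain ⟨m₁, hm₁⟩ := ih₁
    obtain ⟨m₂, hm₂⟩ := ih₂
    refine ⟨max m₁ m₂, fun N₁ N₂ _ _ β₁ β₂ h₁ h₂ r₁ r₂ v v' xs ys h => ?_⟩
    rw [BoundedFormula.realize_imp, BoundedFormula.realize_imp,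
      hm₁ N₁ N₂ β₁ β₂ h₁ h₂ r₁ r₂ v v' xs ys (h.mono (le_max_left _ _)),
      hm₂ N₁ N₂ β₁ β₂ h₁ h₂ r₁ r₂ v v' xs ys (h.mono (le_max_right _ _))]
  | @all l φ ih =>
    obtain ⟨m₁, hm₁⟩ := ih
    -- A quantifier costs the level from which Extension covers all `d`-tuples from the current
    -- variables.
    obtain ⟨m₂, hm₂⟩ := H.exists_bounds (Nat.card (α ⊕ Fin l))
    refine ⟨max m₁ m₂, fun N₁ N₂ _ _ β₁ β₂ h₁ h₂ r₁ r₂ v v' xs ys h => ?_⟩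
    have hm := hm₂.mono le_rfl (le_max_right m₁ m₂)
    rw [BoundedFormula.realize_all, BoundedFormula.realize_all]
    constructor
    · intro hφ y
      obtain ⟨x, hx⟩ := h.symm.exists_snoc h₂ h₁ r₁ hm y
      exact (hm₁ N₁ N₂ β₁ β₂ h₁ h₂ r₁ r₂ _ _ _ _ (hx.symm.mono (le_max_left _ _))).1 (hφ x)
    · intro hφ x
      obtain ⟨y, hy⟩ := h.exists_snoc h₁ h₂ r₂ hm x
      exact (hm₁ N₁ N₂ β₁ β₂ h₁ h₂ r₁ r₂ _ _ _ _ (hy.mono (le_max_left _ _))).2 (hφ y)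

section Embedding

variable {M N : Type*} [H.lang.Structure M] [H.lang.Structure N]

theorem relMap_embedding_iff (e : M ↪[H.lang] N) (x : Fin (d + 1) → M) :
    Structure.RelMap H.symR (e ∘ x) ↔ Structure.RelMap H.symR x := e.map_rel _ x

theorem IsBranched.branch_embedding {β : M → ∀ n, Fin (H.size n)} {γ : N → ∀ n, Fin (H.size n)}
    (hβ : H.IsBranched M β) (hγ : H.IsBranched N γ) (e : M ↪[H.lang] N) (x : M) : γ (e x) = β x := by
  funext n
  have h := e.map_rel (H.symQ fun i : Fin (n + 1) => β x i) fun _ => x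
  have h' := (hγ.node_iff _ _).1 (h.2 ((hβ.node_iff _ _).2 fun i => rfl))
  exact h' (Fin.last n)

theorem sim_embedding {N' : Type*} [H.lang.Structure N'] {β : M → ∀ n, Fin (H.size n)}
    {γ : N → ∀ n, Fin (H.size n)} {γ' : N' → ∀ n, Fin (H.size n)} (hβ : H.IsBranched M β)
    (hγ : H.IsBranched N γ) (hγ' : H.IsBranched N' γ') (e : M ↪[H.lang] N) (e' : M ↪[H.lang] N')
    (m : ℕ) {ι : Type*} (a : ι → M) : Sim γ γ' m (e ∘ a) (e' ∘ a) where
  eq_iff i j := by simp [e.injective.eq_iff, e'.injective.eq_iff]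
  rel_iff t := (relMap_embedding_iff e _).trans (relMap_embedding_iff e' _).symm
  branch_eq i n _ := by
    rw [Function.comp_apply, Function.comp_apply, hβ.branch_embedding hγ, hβ.branch_embedding hγ']

end Embedding

/-- Embeddings preserve branches and `R`, so the two images of a tuple from `M` are similar at every
level, and `exists_level` applies. -/
theorem isModelCompletion_richTheory : IsModelCompletion.{0, 0, w} H.T₀ H.richTheory where
  models σ hσ := Theory.models_sentence_of_mem (Or.inl hσ)
  embeds M := by
    obtain ⟨β, hβ⟩ := exists_isBranched (H := H) (N := M) M.is_model
    let _ := FreeExt.struc β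
    have := (FreeExt.isRich β).model (FreeExt.isBranched β)
    have : Nonempty (H.FreeExt M) := M.nonempty'.map FreeExt.base
    exact ⟨Theory.ModelType.of _ (H.FreeExt M), ⟨FreeExt.embedding hβ⟩⟩
  complete M N₁ N₂ e₁ e₂ n φ a := by
    obtain ⟨β, hβ⟩ := exists_isBranched (H := H) (N := M) M.is_model
    have t₁ : N₁ ⊨ H.T₀ := N₁.is_model.mono Set.subset_union_left
    have t₂ : N₂ ⊨ H.T₀ := N₂.is_model.mono Set.subset_union_left
    obtain ⟨γ₁, h₁⟩ := exists_isBranched t₁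
    obtain ⟨γ₂, h₂⟩ := exists_isBranched t₂
    obtain ⟨m, hm⟩ := exists_level.{w} φ
    have := hm N₁ N₂ γ₁ γ₂ h₁ h₂ (isRich_of_model h₁ N₁.is_model) (isRich_of_model h₂ N₂.is_model)
      (e₁ ∘ a) (e₂ ∘ a) default default
    refine this ?_
    have hs := (sim_embedding hβ h₁ h₂ e₁ e₂ m a).comp (Sum.elim id Fin.elim0)
    convert hs using 1 <;>
    · funext i
      rcases i with i | i
      · rfl
      · exact i.elim0

end Template

/-! ### Arbitrary model completions and the 1167-like property -/

namespace Template

variable {d : ℕ} {H : Template d}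

theorem model_T₀_of_models {T : H.lang.Theory} (hT : ∀ σ ∈ H.T₀, T ⊨ᵇ σ) (N : Type*)
    [H.lang.Structure N] [N ⊨ T] [Nonempty N] : N ⊨ H.T₀ :=
  ⟨fun σ hσ => (hT σ hσ).realize_sentence N⟩

/-- Every model of a model completion of `T₀(H)` is rich. -/
theorem isRich_of_isModelCompletion {T : H.lang.Theory} (hT : IsModelCompletion.{0, 0, w} H.T₀ T)
    (N : T.ModelType.{0, 0, w}) {β : N → ∀ n, Fin (H.size n)} (hβ : H.IsBranched N β) :
    H.IsRich N β := by
  have := hβ.model_T₀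
  -- Take `N ⊆ N₁ ⊆ N₂` with `N₁` rich and `N₂` a model of `T`. A link over `N` is realized in `N₁`,
  -- hence in `N₂`. Completeness of `T` with the diagram of `N` brings its existence down to `N`.
  obtain ⟨N₁, ⟨e₁⟩⟩ := isModelCompletion_richTheory.embeds (Theory.ModelType.of H.T₀ N)
  have t₁ : N₁ ⊨ H.T₀ := N₁.is_model.mono Set.subset_union_left
  obtain ⟨β₁, h₁⟩ := exists_isBranched t₁
  obtain ⟨N₂, ⟨e₂⟩⟩ := hT.embeds (Theory.ModelType.of H.T₀ N₁)
  obtain ⟨β₂, h₂⟩ := exists_isBranched (model_T₀_of_models hT.models N₂)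
  change N ↪[H.lang] N₁ at e₁
  change N₁ ↪[H.lang] N₂ at e₂
  intro r m hm x hx ν S hS
  have key := hT.complete (Theory.ModelType.of H.T₀ N) N N₂ (Embedding.refl H.lang N)
    (e₂.comp e₁) r ((∃' (H.linkFormula ν S)).toFormula.relabel (Sum.elim Empty.elim id)) x
  have realize : ∀ {P : Type w} [H.lang.Structure P] {γ : P → ∀ n, Fin (H.size n)},
      H.IsBranched P γ → ∀ z : Fin r → P,
      (((∃' (H.linkFormula ν S)).toFormula.relabel (Sum.elim Empty.elim id) :
        H.lang.Formula (Fin r)).Realize z ↔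
      ∃ y, (∀ i : Fin m, γ y i = ν i) ∧ (∀ i, y ≠ z i) ∧ ∀ t : Fin d → Fin r,
        (Structure.RelMap H.symR (Fin.cons y (z ∘ t) : Fin (d + 1) → P) ↔ t ∈ S)) := by
    intro P _ γ hγ z
    rw [Formula.realize_relabel, BoundedFormula.realize_toFormula, BoundedFormula.realize_ex]
    exact exists_congr fun y => (realize_linkFormula _ _ _ _ _).trans
      (and_congr_left fun _ => hγ.node_iff ν y)
  rw [realize h₂, realize hβ] at key
  have e₁β : ∀ i, β₁ (e₁ (x i)) = β (x i) := fun i => hβ.branch_embedding h₁ e₁ (x i)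
  obtain ⟨y, hy, hν, hR⟩ := isRich_of_model h₁ N₁.is_model r m hm (e₁ ∘ x) (e₁.injective.comp hx) ν S
    ⟨hS.injective, hS.perm, by simpa only [Function.comp_apply, e₁β] using hS.edge⟩
  obtain ⟨y', h1, h2, h3⟩ := key.2 ⟨e₂ y, fun i => by rw [h₁.branch_embedding h₂, hν],
    fun i e => hy i (e₂.injective e), fun t => by
      rw [← hR t, ← relMap_embedding_iff e₂]
      refine iff_of_eq (congrArg _ ?_)
      funext j
      cases j using Fin.cases <;> rfl⟩
  exact ⟨y', h2, h1, h3⟩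

/-- The variables lie in the sets named by `η`. -/
noncomputable def nodeFormula {m : ℕ} (η : Fin d → H.Node m) : H.lang.Formula (Fin d) :=
  Formula.iInf fun i => (H.symQ (η i)).formula fun _ => Term.var i

theorem nodeFormula_mem_typeOf_iff {T : H.lang.Theory} {N : Type*} [H.lang.Structure N] [N ⊨ T]
    [Nonempty N] {β : N → ∀ n, Fin (H.size n)} (hβ : H.IsBranched N β) {m : ℕ}
    (η : Fin d → H.Node m) (a : Fin d → N) :
    Formula.equivSentence (nodeFormula η) ∈ T.typeOf a ↔ (fun i (n : Fin m) => β (a i) n) = η := by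
  rw [Theory.CompleteType.formula_mem_typeOf, nodeFormula, Formula.realize_iInf]
  simp only [Formula.realize_rel, Term.realize_var, hβ.node_iff, funext_iff]

theorem existsUnique_nodeFormula_mem {T : H.lang.Theory} (hT : ∀ σ ∈ H.T₀, T ⊨ᵇ σ)
    (p : T.CompleteType (Fin d)) (m : ℕ) :
    ∃! η : Fin d → H.Node m, Formula.equivSentence (nodeFormula η) ∈ p := by
  obtain ⟨N, a, rfl⟩ := Theory.exists_modelType_is_realized_in T p
  obtain ⟨β, hβ⟩ := exists_isBranched (model_T₀_of_models hT N)
  simp only [nodeFormula_mem_typeOf_iff hβ]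
  exact existsUnique_eq'

theorem card_lang_le : H.lang.card ≤ Cardinal.aleph0 := by
  let g : Option (Σ m, H.Node m) → Σ l, H.lang.Relations l := fun o =>
    o.elim ⟨d + 1, Rel.R⟩ fun η => ⟨1, Rel.Q η.2⟩
  have hg : Function.Surjective g := by
    rintro ⟨_, _ | η⟩
    · exact ⟨none, rfl⟩
    · exact ⟨some ⟨_, η⟩, rfl⟩
  have := hg.countable
  have : ∀ l, Countable (H.lang.Functions l) := fun l => inferInstanceAs (Countable Empty)
  exact Cardinal.mk_le_aleph0_iff.2 inferInstance

theorem realize_edgeFormula {N : Type*} [H.lang.Structure N] (x : Fin 1 → N) (a : Fin d → N) :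
    H.edgeFormula.Realize (Sum.elim x a) ↔
      Structure.RelMap H.symR (Fin.cons (x 0) a : Fin (d + 1) → N) := by
  rw [edgeFormula, Formula.realize_rel]
  refine iff_of_eq (congrArg _ ?_)
  funext j
  cases j using Fin.cases <;> rfl

theorem exists_edge_of_typeOf_mem {T : H.lang.Theory} {N : Type*} [H.lang.Structure N] [N ⊨ T]
    [Nonempty N] {a : Fin d → N} (h : T.typeOf a ∈ typesP T H.edgeFormula) :
    ∃ x, Structure.RelMap H.symR (Fin.cons x a : Fin (d + 1) → N) := by
  have h : Formula.equivSentence (exFormula H.edgeFormula) ∈ T.typeOf a := h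
  rw [Theory.CompleteType.formula_mem_typeOf, exFormula, Formula.realize_iExs] at h
  obtain ⟨x, hx⟩ := h
  rw [Formula.realize_relabel] at hx
  have e : Sum.elim a x ∘ Sum.swap = Sum.elim x a := by
    funext i
    cases i <;> rfl
  rw [e, realize_edgeFormula] at hx
  exact ⟨x 0, hx⟩

/-- In a rich structure, common neighbours of `s` many tuples only depend on an initial segment of
the branches. -/
theorem IsRich.isPartialType_of_branch_eq {N : Type*} [H.lang.Structure N]
    {β : N → ∀ n, Fin (H.size n)} (h : H.IsRich N β) (hβ : H.IsBranched N β) {s m : ℕ}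
    (hm : H.Bounds (s * d) m) {a b : Fin s → Fin d → N} (hb : ∀ l, Function.Injective (b l))
    (hab : ∀ l i, ∀ n < m, β (a l i) n = β (b l i) n) (ha : IsPartialType H.edgeFormula a) :
    IsPartialType H.edgeFormula b := by
  obtain ⟨x, hx⟩ := ha
  simp only [realize_edgeFormula] at hx
  let A : Set N := Set.range fun p : Fin s × Fin d => b p.1 p.2
  have hA : A.ncard ≤ s * d := by
    have : A.ncard ≤ (Set.univ : Set (Fin s × Fin d)).ncard := by
      rw [show A = (fun p : Fin s × Fin d => b p.1 p.2) '' Set.univ from Set.image_univ.symm]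
      exact Set.ncard_image_le Set.finite_univ
    simpa [Set.ncard_univ] using this
  have edge : ∀ t ∈ {t : Fin d → N | ∃ l, ∃ σ : Equiv.Perm (Fin d), t = b l ∘ σ}, ∀ n : Fin m,
      H.edge n (Fin.cons (β (x 0) n) fun j => β (t j) n) := by
    rintro _ ⟨l, σ, rfl⟩ n
    convert edge_perm (hβ.edge _ (hx l) n) (Equiv.Perm.decomposeFin.symm (0, σ)) using 1
    funext j
    cases j using Fin.cases with
    | zero => simp
    | succ j => simp [hab l (σ j) n n.2]
  -- The new vertex gets the node of `x 0` of length `m` and, as link, all rearrangements of the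
  -- tuples `b l`.
  obtain ⟨y, -, -, hR⟩ := h.exists_of_finite (A := A) (Set.finite_range _) (hm.mono hA le_rfl)
    (fun n => β (x 0) n) {t | ∃ l, ∃ σ : Equiv.Perm (Fin d), t = b l ∘ σ}
    (by rintro _ ⟨l, σ, rfl⟩; exact (hb l).comp σ.injective)
    (by rintro _ ⟨l, σ, rfl⟩ τ; exact ⟨l, σ * τ, rfl⟩) edge
  refine ⟨fun _ => y, fun l => ?_⟩
  rw [realize_edgeFormula]
  exact (hR (b l) fun j => ⟨(l, j), rfl⟩).2 ⟨l, 1, rfl⟩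

theorem is1167Like_of_isModelCompletion {T : H.lang.Theory}
    (hT : IsModelCompletion.{0, 0, w} H.T₀ T) : Is1167Like.{0, 0, w} T H.edgeFormula := by
  choose F hF hFu using existsUnique_nodeFormula_mem hT.models
  -- `F p m` lists the nodes of length `m` that `p` prescribes; `code m` turns the list into a
  -- number. The formula `nodeFormula (F p m)` witnesses continuity at `m`.
  choose code hcode using fun m => (Countable.exists_injective_nat (Fin d → H.Node m))
  refine ⟨card_lang_le, fun p m => code m (F p m), fun p _ m => ⟨_, hF p m, fun q _ hq => ?_⟩,
    fun s _ => ?_⟩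
  · exact congrArg (code m) (hFu q m _ hq).symm
  · obtain ⟨m, hm⟩ := H.exists_bounds (s * d)
    -- The value at index `m` already codes all entries below `m`; `m + 1` makes that index
    -- available.
    refine ⟨m + 1, fun M a b _ hb hab ha => ?_⟩
    obtain ⟨β, hβ⟩ := exists_isBranched (model_T₀_of_models hT.models M)
    have hF' : ∀ c : Fin d → M, (fun i (n : Fin m) => β (c i) n) = F (T.typeOf c) m :=
      fun c => (nodeFormula_mem_typeOf_iff hβ _ c).1 (hF _ m)
    refine (isRich_of_isModelCompletion hT M hβ).isPartialType_of_branch_eq hβ hm (fun l => ?_)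
      (fun l i n hn => ?_) ha
    -- Membership in `𝒫` puts `b l` in an edge, so its entries are distinct.
    · obtain ⟨x, hx⟩ := exists_edge_of_typeOf_mem (hb l)
      exact (Fin.cons_injective_iff.1 (hβ.injective _ hx)).2
    · have := hcode m (hab l m m.lt_succ_self)
      rw [← hF', ← hF'] at this
      exact congrFun (congrFun this i) ⟨n, hn⟩

end Template

theorem claimc {d : ℕ} (H : Template d) :
    (∃ T : H.lang.Theory, IsModelCompletion.{0, 0, w} H.T₀ T) ∧
    ∀ T : H.lang.Theory, IsModelCompletion.{0, 0, w} H.T₀ T →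
      Is1167Like.{0, 0, w} T H.edgeFormula :=
  ⟨⟨H.richTheory, Template.isModelCompletion_richTheory⟩,
    fun _ hT => Template.is1167Like_of_isModelCompletion hT⟩
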